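/- All spaces are based, path-connected and of the homotopy type of a CW-complex; $[X,Y]$ is the set of based homotopy classes of based maps, and $\mathcal E(X)\subseteq[X,X]$ consists of the classes that have a two-sided inverse under composition. For $0\le n\le\infty$ let $$\mathcal A^n_\sharp(X)=\{f\in[X,X] : \pi_k(f)\colon\pi_k(X)\to\pi_k(X)\text{ is bijective for all } k\le n\ (k<\infty)\}.$$ A self-closeness number $N\mathcal E(X)$ is the minimum of $\{n\in\mathbb N\cup\{\infty\} : \mathcal A^n_\sharp(X)=\mathcal E(X)\}$. For $f\in[X\times Y,X\times Y]$ put $f_X=p_X\circ f$, $f_Y=p_Y\circ f$, $f_{XX}=p_X\circ f\circ i_X$, where $p_X,p_Y$ are the projections and $i_X(x)=(x,*)$. The monoid $\mathcal A^n_\sharp(X\times Y)$ is called reducible if $f=(f_X,f_Y)\in\mathcal A^n_\sharp(X\times Y)$ implies $(p_X,f_Y)\in\mathcal A^n_\sharp(X\times Y)$ and $(f_X,p_Y)\in\mathcal A^n_\sharp(X\times Y)$. The spaces $X$ and $Y$ are homotopically $n$-distant if for all $a\in[Y,X]$, $b\in[X,Y]$ and all finite $k\le n$ the endomorphism $\pi_k(b\circ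 a)$ of $\pi_k(Y)$ is nilpotent (some iterate of it is trivial). **Proposition.** Let $n\in\mathbb N\cup\{\infty\}$ with $n\ge N\mathcal E(X)$. Suppose that for each finite $k$ with $1\le k\le n$ the group $\pi_k(Y)$ is abelian of finite rank (it has a finitely generated subgroup with torsion quotient; e.g. $\pi_k(Y)$ is torsion or finitely generated), and that for each prime $p$ its $p$-primary component is finite and isomorphic to a subgroup of $\bigoplus_{i=1}^{\infty}\mathbb Z/p^i$. If $X$ and $Y$ are homotopically $n$-distant, then $\mathcal A^n_\sharp(X\times Y)$ is reducible if and only if $f_{XX}\in\mathcal E(X)$ for every $f\in\mathcal A^n_\sharp(X\times Y)$. -/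

import Mathlib

open scoped Topology DirectSum

universe u v w

/-- A topological space with a chosen base point. -/
structure BasedSpace : Type (u + 1) where
  carrier : Type u
  [top : TopologicalSpace carrier]
  pt : carrier

attribute [instance] BasedSpace.top

namespace BasedSpace

/-- The product space, based at the pair of base points. -/
def prod (X : BasedSpace.{u}) (Y : BasedSpace.{v}) : BasedSpace.{max u v} where
  carrier := X.carrier × Y.carrier
  pt := (X.pt, Y.pt)

/-- The underlying space is homotopy equivalent to a CW complex. -/
def HasCWHomotopyType (X : BasedSpace.{u}) : Prop :=
  ∃ (K : Type u) (_ : TopologicalSpace K), T2Space K ∧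
    Nonempty (Topology.CWComplex (Set.univ : Set K)) ∧
    Nonempty (ContinuousMap.HomotopyEquiv X.carrier K)

/-- Base-point-preserving continuous maps. -/
def Map (X : BasedSpace.{u}) (Y : BasedSpace.{v}) : Type (max u v) :=
  {f : C(X.carrier, Y.carrier) // f X.pt = Y.pt}

/-- Based homotopy of based maps: homotopy relative to the base point. -/
instance mapSetoid (X : BasedSpace.{u}) (Y : BasedSpace.{v}) : Setoid (Map X Y) where
  r f g := ContinuousMap.HomotopicRel f.1 g.1 {X.pt}
  iseqv :=
    ⟨fun f => ContinuousMap.HomotopicRel.refl f.1, fun h => h.symm, fun h₁ h₂ => h₁.trans h₂⟩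

/-- The set `[X, Y]` of based homotopy classes of based maps. -/
def HtpyClass (X : BasedSpace.{u}) (Y : BasedSpace.{v}) : Type (max u v) :=
  Quotient (mapSetoid X Y)

theorem homotopicRel_comp {X : BasedSpace.{u}} {Y : BasedSpace.{v}} {Z : BasedSpace.{w}}
    {g₀ g₁ : Map Y Z} {f₀ f₁ : Map X Y}
    (hg : ContinuousMap.HomotopicRel g₀.1 g₁.1 {Y.pt})
    (hf : ContinuousMap.HomotopicRel f₀.1 f₁.1 {X.pt}) :
    ContinuousMap.HomotopicRel (g₀.1.comp f₀.1) (g₁.1.comp f₁.1) {X.pt} := by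
  refine (hf.comp_continuousMap g₀.1).trans ?_
  obtain ⟨G⟩ := hg
  refine ⟨⟨G.toHomotopy.comp (ContinuousMap.Homotopy.refl f₁.1), ?_⟩⟩
  intro t x hx
  obtain rfl : x = X.pt := hx
  have h := G.prop t Y.pt rfl
  simpa [f₁.2] using h

namespace HtpyClass

/-- The class of the identity map. -/
def id (X : BasedSpace.{u}) : HtpyClass X X :=
  Quotient.mk _ ⟨ContinuousMap.id X.carrier, rfl⟩

/-- Composition of homotopy classes, `g.comp f = [g ∘ f]`. -/
def comp {X : BasedSpace.{u}} {Y : BasedSpace.{v}} {Z : BasedSpace.{w}}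
    (g : HtpyClass Y Z) (f : HtpyClass X Y) : HtpyClass X Z :=
  Quotient.map₂ (fun (g : Map Y Z) (f : Map X Y) =>
      (⟨g.1.comp f.1, (congrArg g.1 f.2).trans g.2⟩ : Map X Z))
    (fun _ _ hg _ _ hf => homotopicRel_comp hg hf) g f

/-- The class of the map `(f, g) : Z → X × Y` with components `f` and `g`. -/
def pair {X : BasedSpace.{u}} {Y : BasedSpace.{v}} {Z : BasedSpace.{w}}
    (f : HtpyClass Z X) (g : HtpyClass Z Y) : HtpyClass Z (X.prod Y) :=
  Quotient.map₂ (fun (f : Map Z X) (g : Map Z Y) =>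
      (⟨ContinuousMap.prodMk f.1 g.1, Prod.ext f.2 g.2⟩ : Map Z (X.prod Y)))
    (fun _ _ hf _ _ hg => Nonempty.map2 ContinuousMap.HomotopyRel.prod hf hg) f g

end HtpyClass

section ProductMaps

variable (X : BasedSpace.{u}) (Y : BasedSpace.{v})

/-- The projection `p_X : X × Y → X`. -/
def projFst : HtpyClass (X.prod Y) X := Quotient.mk _ ⟨⟨Prod.fst, continuous_fst⟩, rfl⟩

/-- The projection `p_Y : X × Y → Y`. -/
def projSnd : HtpyClass (X.prod Y) Y := Quotient.mk _ ⟨⟨Prod.snd, continuous_snd⟩, rfl⟩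

/-- The inclusion `i_X : X → X × Y`, `x ↦ (x, *)`. -/
def inclFst : HtpyClass X (X.prod Y) :=
  Quotient.mk _ ⟨⟨fun x => (x, Y.pt), by fun_prop⟩, rfl⟩

end ProductMaps

/-- The homotopy "group" `π_k(X)` at the base point (a pointed set for `k = 0`). -/
abbrev Pi (k : ℕ) (X : BasedSpace.{u}) : Type u := HomotopyGroup.Pi k X.carrier X.pt

/-- The trivial element of `π_k(X)`: the class of the constant map. -/
def piTrivial (k : ℕ) (X : BasedSpace.{u}) : Pi k X :=
  Quotient.mk (GenLoop.Homotopic.setoid (Fin k) X.pt) GenLoop.const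

/-- The map `π_k(X) → π_k(Y)` induced by a based map, `[p] ↦ [f ∘ p]`. -/
def Map.onPi {X : BasedSpace.{u}} {Y : BasedSpace.{v}} (k : ℕ) (f : Map X Y) :
    Pi k X → Pi k Y :=
  Quotient.map (sa := GenLoop.Homotopic.setoid (Fin k) X.pt)
    (sb := GenLoop.Homotopic.setoid (Fin k) Y.pt)
    (fun p => ⟨f.1.comp p.1, fun y hy => (congrArg f.1 (p.2 y hy)).trans f.2⟩)
    (fun _ _ h => ContinuousMap.HomotopicRel.comp_continuousMap h f.1)

theorem Map.onPi_congr {X : BasedSpace.{u}} {Y : BasedSpace.{v}} (k : ℕ) {f g : Map X Y}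
    (h : ContinuousMap.HomotopicRel f.1 g.1 {X.pt}) : f.onPi k = g.onPi k := by
  funext a
  induction a using Quotient.inductionOn with
  | h p =>
    refine Quotient.sound ?_
    obtain ⟨H⟩ := h
    refine ⟨⟨H.toHomotopy.comp (ContinuousMap.Homotopy.refl p.1), ?_⟩⟩
    intro t y hy
    have hpy : p.1 y = X.pt := p.2 y hy
    change H (t, p.1 y) = f.1 (p.1 y)
    rw [hpy]
    exact H.prop t X.pt rfl

/-- The map `π_k(f) : π_k(X) → π_k(Y)` induced by `f ∈ [X, Y]`. -/
def HtpyClass.onPi {X : BasedSpace.{u}} {Y : BasedSpace.{v}} (k : ℕ) (f : HtpyClass X Y) :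
    Pi k X → Pi k Y :=
  Quotient.lift (fun f : Map X Y => f.onPi k) (fun _ _ h => Map.onPi_congr k h) f

/-- `𝓔(X)`: the classes in `[X, X]` of self-homotopy equivalences. -/
def selfEquivs (X : BasedSpace.{u}) : Set (HtpyClass X X) :=
  {f | ∃ g : HtpyClass X X, g.comp f = HtpyClass.id X ∧ f.comp g = HtpyClass.id X}

/-- `𝓐ⁿ(X)`, `0 ≤ n ≤ ∞`: the classes in `[X, X]` inducing automorphisms of `π_k(X)` for all
(finite) `k ≤ n`. -/
def A (n : ℕ∞) (X : BasedSpace.{u}) : Set (HtpyClass X X) :=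
  {f | ∀ k : ℕ, (k : ℕ∞) ≤ n → Function.Bijective (f.onPi k)}

/-- `N` is the self-closeness number of `X`: `N = min {n | 𝓐ⁿ(X) = 𝓔(X)}`. -/
def IsSelfClosenessNumber (X : BasedSpace.{u}) (N : ℕ∞) : Prop :=
  IsLeast {n : ℕ∞ | A n X = selfEquivs X} N

/-- `f_XX = p_X ∘ f ∘ i_X`. -/
def blockFst {X : BasedSpace.{u}} {Y : BasedSpace.{v}}
    (f : HtpyClass (X.prod Y) (X.prod Y)) : HtpyClass X X :=
  ((projFst X Y).comp f).comp (inclFst X Y)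

/-- `𝓐ⁿ(X × Y)` is reducible: if `f = (f_X, f_Y)` belongs to it, then so do `(p_X, f_Y)` and
`(f_X, p_Y)`. -/
def IsReducible (n : ℕ∞) (X : BasedSpace.{u}) (Y : BasedSpace.{v}) : Prop :=
  ∀ f ∈ A n (X.prod Y),
    (projFst X Y).pair ((projSnd X Y).comp f) ∈ A n (X.prod Y) ∧
    ((projFst X Y).comp f).pair (projSnd X Y) ∈ A n (X.prod Y)

/-- `X` and `Y` are homotopically `n`-distant: every self-map of `Y` that factors through `X`
induces a nilpotent endomorphism of `π_k(Y)` for each `k ≤ n`. -/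
def HomotopicallyDistant (n : ℕ∞) (X : BasedSpace.{u}) (Y : BasedSpace.{v}) : Prop :=
  ∀ (a : HtpyClass Y X) (b : HtpyClass X Y) (k : ℕ), (k : ℕ∞) ≤ n →
    ∃ m : ℕ, ∀ x : Pi k Y, ((b.comp a).onPi k)^[m] x = piTrivial k Y

end BasedSpace

/-- An abelian group has finite (torsion-free) rank: some finitely generated subgroup has torsion
quotient. All torsion groups and all finitely generated groups have finite rank. -/
def HasFiniteRank (G : Type u) [CommGroup G] : Prop :=
  ∃ S : Finset G, ∀ x : G, ∃ m : ℕ, 0 < m ∧ x ^ m ∈ Subgroup.closure (S : Set G)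

/-- The `p`-primary component of `G` is isomorphic to a subgroup of `⨁_{i ≥ 1} ℤ/pⁱ`. -/
def PrimaryComponentEmbeds (G : Type u) [CommGroup G] (p : ℕ) [Fact p.Prime] : Prop :=
  ∃ φ : Additive (CommGroup.primaryComponent G p) →+ ⨁ i : ℕ, ZMod (p ^ (i + 1)),
    Function.Injective φ

/-- `G` is abelian of finite rank, and for every prime `p` its `p`-primary component is finite and
isomorphic to a subgroup of `⨁_{i ≥ 1} ℤ/pⁱ`. -/
def HasSmallPrimaryComponents (G : Type u) [Group G] : Prop :=
  ∃ h : ∀ a b : G, a * b = b * a,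
    letI : CommGroup G := { (inferInstance : Group G) with mul_comm := h }
    HasFiniteRank G ∧
      ∀ (p : ℕ) [Fact p.Prime],
        Finite (CommGroup.primaryComponent G p) ∧ PrimaryComponentEmbeds G p

/-! For `k ≥ 1` a self-map `f` of `X × Y` acts on `π_k(X) × π_k(Y)` as a block matrix `(A B; C D)`,
while `(f_X, p_Y)` and `(p_X, f_Y)` act as triangular matrices with diagonals `(A, 1)` and `(1, D)`.
Reducibility thus makes `A` bijective for all `k ≤ n`, and `n ≥ N𝓔(X)` turns `f_XX` into an
equivalence.

Conversely, let `e` be inverse to `f_XX` and `E = A⁻¹` the map it induces. The point is that `D` is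
bijective. The Schur complement `D - N`, `N = C E B`, is bijective; if `U` is its inverse, then `D =
(1 + N U)(D - N)`, so it suffices that `N U` be locally nilpotent (`bijective_of_bijective_sub`).
Distance makes `N q` nilpotent whenever `E B q` is induced by a map `Y → X`. This holds for every
sum `q` of words in `D` and `N`, since `e ∘ f_X ∘ (a, v)` induces `a + E B v`
(`bijective_onPi_blockSnd`). Over `ℚ`, traces carry this from words to the algebra they span, which
contains `U`. On the finite `m`-torsion, `U` is itself a power of `D + (m - 1) N`. -/

/-! ### Trace criteria for nilpotency -/

open Polynomial in
/-- In characteristic zero, an endomorphism all of whose positive powers have trace zero is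
nilpotent. -/
theorem LinearMap.isNilpotent_of_forall_trace_pow_succ_eq_zero {K V : Type*} [Field K] [CharZero K]
    [AddCommGroup V] [Module K V] [FiniteDimensional K V] (T : Module.End K V)
    (h : ∀ k : ℕ, LinearMap.trace K V (T ^ (k + 1)) = 0) : IsNilpotent T := by
  have htr : ∀ p : K[X], LinearMap.trace K V (aeval T (p * X)) = 0 := by
    intro p
    induction p using Polynomial.induction_on' with
    | add p q hp hq => rw [add_mul, map_add, map_add, hp, hq, add_zero]
    | monomial n a =>
      rw [← C_mul_X_pow_eq_monomial, mul_assoc, ← pow_succ, map_mul, aeval_C, map_pow, aeval_X,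
        Algebra.algebraMap_eq_smul_one, smul_mul_assoc, one_mul, map_smul, h, smul_zero]
  have hne : minpoly K T ≠ 0 := minpoly.ne_zero (Algebra.IsIntegral.isIntegral T)
  obtain ⟨q, hq, hdvd⟩ := exists_eq_pow_rootMultiplicity_mul_and_not_dvd _ hne (0 : K)
  set r := rootMultiplicity (0 : K) (minpoly K T)
  rw [C_0, sub_zero] at hq hdvd
  -- The exponent `r + 1`, not `r`, makes the idempotent below a multiple of `T` even when `r = 0`,
  -- so its trace vanishes.
  have hcop : IsCoprime (X ^ (r + 1)) q :=
    ((prime_X.irreducible.coprime_iff_not_dvd).2 hdvd).pow_left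
  obtain ⟨s, t, hst⟩ := hcop
  have hzero : aeval T (X ^ r * q) = 0 := by rw [← hq, minpoly.aeval]
  have hsum : aeval T (s * X ^ (r + 1)) + aeval T (t * q) = 1 := by
    rw [← map_add, hst, map_one]
  have hprod : aeval T (s * X ^ (r + 1)) * aeval T (t * q) = 0 := by
    rw [← map_mul, show s * X ^ (r + 1) * (t * q) = s * X * t * (X ^ r * q) by ring, map_mul,
      hzero, mul_zero]
  have hidem : IsIdempotentElem (aeval T (s * X ^ (r + 1))) := by
    rw [eq_sub_of_add_eq' hsum] at hprod
    exact (sub_eq_zero.1 (by rw [← hprod, mul_sub, mul_one])).symm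
  have htr0 : LinearMap.trace K V (aeval T (s * X ^ (r + 1))) = 0 := by
    rw [pow_succ, ← mul_assoc]
    exact htr _
  have he : aeval T (s * X ^ (r + 1)) = 0 :=
    LinearMap.IsIdempotentElem.eq_zero_of_trace_eq_zero hidem htr0
  refine ⟨r, ?_⟩
  rw [he, zero_add] at hsum
  calc T ^ r = aeval T (X ^ r) * aeval T (t * q) := by simp [hsum]
    _ = 0 := by
      rw [← map_mul, show X ^ r * (t * q) = t * (X ^ r * q) by ring, map_mul, hzero, mul_zero]

/-- If `N * w` is nilpotent for every word `w` in `D` and `N`, and `D - N` is invertible with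
inverse `U`, then `N * U` is nilpotent. -/
theorem isNilpotent_mul_of_forall_word {K V : Type*} [Field K] [CharZero K]
    [AddCommGroup V] [Module K V] [FiniteDimensional K V] (D N U : Module.End K V)
    (hnil : ∀ w ∈ Submonoid.closure {D, N}, IsNilpotent (N * w)) (hU : (D - N) * U = 1) :
    IsNilpotent (N * U) := by
  set Q := Algebra.adjoin K {D, N} with hQ
  have hD : D ∈ Q := Algebra.subset_adjoin (by simp)
  have hN : N ∈ Q := Algebra.subset_adjoin (by simp)
  have hU' : U * (D - N) = 1 := mul_eq_one_comm.1 hU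
  -- Nilpotency does not pass to sums, but vanishing of the trace does.
  have htr : ∀ x ∈ Q, LinearMap.trace K V (N * x) = 0 := by
    intro x hx
    have hx' : x ∈ Submodule.span K (Submonoid.closure {D, N} : Set (Module.End K V)) := by
      rw [← Algebra.adjoin_eq_span]; exact hx
    induction hx' using Submodule.span_induction with
    | mem w hw => exact (LinearMap.isNilpotent_trace_of_isNilpotent (hnil w hw)).eq_zero
    | zero => simp
    | add a b ha hb iha ihb =>
      rw [← Algebra.adjoin_eq_span] at ha hb
      rw [mul_add, map_add, iha ha, ihb hb, add_zero]
    | smul c a ha iha =>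
      rw [← Algebra.adjoin_eq_span] at ha
      rw [mul_smul_comm, map_smul, iha ha, smul_zero]
  -- Left multiplication by `D - N` is injective on the finite-dimensional algebra `Q`, hence hits
  -- `1`.
  have hUQ : U ∈ Q := by
    let S : Q := ⟨D - N, sub_mem hD hN⟩
    have hinj : Function.Injective (LinearMap.mulLeft K S) := by
      intro a b hab
      have hab' : (D - N) * (a : Module.End K V) = (D - N) * b := congrArg Subtype.val hab
      apply Subtype.ext
      rw [← one_mul (a : Module.End K V), ← hU', mul_assoc, hab', ← mul_assoc, hU', one_mul]
    obtain ⟨y, hy⟩ := LinearMap.injective_iff_surjective.1 hinj 1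
    have hy' : (D - N) * (y : Module.End K V) = 1 := congrArg Subtype.val hy
    have : U = y := by rw [← mul_one U, ← hy', ← mul_assoc, hU', one_mul]
    rw [this]; exact y.2
  refine LinearMap.isNilpotent_of_forall_trace_pow_succ_eq_zero _ fun k => ?_
  rw [pow_succ', mul_assoc]
  exact htr _ (mul_mem hUQ (pow_mem (mul_mem hN hUQ) k))

/-! ### Endomorphisms of abelian groups of finite rank -/

section AbelianGroup

variable {G : Type*} [AddCommGroup G]

/-- Multiplication by `b` sends the `ab`-torsion to the `a`-torsion, and its fibres lie in
translates of the `b`-torsion. -/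
theorem finite_torsionBy_of_forall_prime (h : ∀ p : ℕ, p.Prime → {x : G | p • x = 0}.Finite)
    (m : ℕ) (hm : m ≠ 0) : {x : G | m • x = 0}.Finite := by
  induction m using Nat.recOnMul with
  | zero => exact absurd rfl hm
  | one => simp
  | prime p hp => exact h p hp
  | mul a b iha ihb =>
    have ha := iha (left_ne_zero_of_mul hm)
    have hb := ihb (right_ne_zero_of_mul hm)
    refine Set.Finite.of_finite_fibers (fun x => b • x) (ha.subset ?_) ?_
    · rintro _ ⟨x, hx, rfl⟩
      simpa [mul_smul] using hx
    · intro y _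
      rcases Set.eq_empty_or_nonempty ({x : G | (a * b) • x = 0} ∩ (fun x => b • x) ⁻¹' {y})
        with h0 | ⟨x₀, hx₀⟩
      · rw [h0]; exact Set.finite_empty
      · refine (hb.image (· + x₀)).subset ?_
        rintro x ⟨-, hx⟩
        refine ⟨x - x₀, ?_, by simp⟩
        have h1 : b • x = y := hx
        have h2 : b • x₀ = y := hx₀.2
        simp [smul_sub, h1, h2]

theorem finiteDimensional_rat_tensorProduct (S : Finset G)
    (hS : ∀ x : G, ∃ m : ℕ, 0 < m ∧ m • x ∈ AddSubgroup.closure (S : Set G)) :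
    FiniteDimensional ℚ (TensorProduct ℤ ℚ G) := by
  classical
  refine ⟨⟨S.image fun x => (1 : ℚ) ⊗ₜ[ℤ] x, ?_⟩⟩
  rw [eq_top_iff]
  rintro z -
  induction z using TensorProduct.induction_on with
  | zero => exact zero_mem _
  | add a b ha hb => exact add_mem ha hb
  | tmul r x =>
    obtain ⟨m, hm, hx⟩ := hS x
    have key : ∀ y ∈ AddSubgroup.closure (S : Set G), (1 : ℚ) ⊗ₜ[ℤ] y ∈
        Submodule.span ℚ ((S.image fun x => (1 : ℚ) ⊗ₜ[ℤ] x : Finset _) : Set _) := by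
      intro y hy
      induction hy using AddSubgroup.closure_induction with
      | mem y hy => exact Submodule.subset_span (by simpa using ⟨y, hy, rfl⟩)
      | zero => simp
      | add a b _ _ ha hb => rw [TensorProduct.tmul_add]; exact add_mem ha hb
      | neg a _ ha => rw [TensorProduct.tmul_neg]; exact neg_mem ha
    have hm' : (m : ℚ) ≠ 0 := by exact_mod_cast hm.ne'
    have : r ⊗ₜ[ℤ] x = (r / m) • ((1 : ℚ) ⊗ₜ[ℤ] (m • x)) := by
      rw [TensorProduct.smul_tmul', smul_eq_mul, mul_one, ← natCast_zsmul x m,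
        ← TensorProduct.smul_tmul]
      congr 1
      simp [mul_div_cancel₀, hm']
    rw [this]
    exact Submodule.smul_mem _ _ (key _ hx)

theorem exists_nsmul_eq_zero_of_one_tmul_eq_zero {x : G} (h : (1 : ℚ) ⊗ₜ[ℤ] x = 0) :
    ∃ m : ℕ, m ≠ 0 ∧ m • x = 0 := by
  have h' : TensorProduct.mk ℤ ℚ G 1 x = 0 := h
  rw [IsLocalizedModule.eq_zero_iff (nonZeroDivisors ℤ)] at h'
  obtain ⟨c, hc⟩ := h'
  refine ⟨(c : ℤ).natAbs, Int.natAbs_ne_zero.2 (nonZeroDivisors.coe_ne_zero c), ?_⟩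
  have hc' : (c : ℤ) • x = 0 := hc
  rcases Int.natAbs_eq (c : ℤ) with h1 | h1
  · rw [h1] at hc'; rwa [natCast_zsmul] at hc'
  · rw [h1, neg_smul, neg_eq_zero] at hc'; rwa [natCast_zsmul] at hc'

theorem Module.End.bijective_one_add_of_locally_nilpotent {R : Type*} [Ring R] [Module R G]
    (K : Module.End R G) (h : ∀ x, ∃ r : ℕ, (K ^ r) x = 0) : Function.Bijective ⇑(1 + K : Module.End R G) := by
  constructor
  · rw [injective_iff_map_eq_zero]
    intro x hx
    obtain ⟨r, hr⟩ := h x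
    have hx' : K x = -x := by
      rw [eq_neg_iff_add_eq_zero, add_comm]; simpa using hx
    have : ∀ r : ℕ, (K ^ r) x = (-1 : ℤ) ^ r • x := by
      intro r
      induction r with
      | zero => simp
      | succ r ih => rw [pow_succ', Module.End.mul_apply, ih, map_zsmul, hx', pow_succ]; simp
    rw [this] at hr
    rcases neg_one_pow_eq_or ℤ r with h1 | h1 <;> simpa [h1] using hr
  · intro y
    obtain ⟨r, hr⟩ := h y
    have hg := (Commute.one_left (-K)).geom_sum₂_comm r
    refine ⟨(∑ i ∈ Finset.range r, (-K) ^ i) y, ?_⟩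
    have h1 : (1 + K) * ∑ i ∈ Finset.range r, (-K) ^ i = 1 - (-K) ^ r := by
      rw [← mul_neg_geom_sum (-K) r, sub_neg_eq_add]
    rw [← Module.End.mul_apply, h1]
    have : ((-K) ^ r) y = 0 := by
      rw [neg_pow]
      rcases neg_one_pow_eq_or (Module.End R G) r with h1 | h1 <;> simp [h1, hr]
    simp [this]

/-- Let `D` and `N` be endomorphisms of an abelian group of finite rank with finite `p`-torsion for
all primes `p`, such that `N * q` is nilpotent for all sums `q` of words in `D` and `N`. If `D - N`
is bijective, then so is `D`. -/
theorem bijective_of_bijective_sub (D N : Module.End ℤ G)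
    (hnil : ∀ q ∈ Subsemiring.closure {D, N}, IsNilpotent (N * q))
    (hS : Function.Bijective (D - N))
    (hrank : ∃ S : Finset G, ∀ x : G, ∃ m : ℕ, 0 < m ∧ m • x ∈ AddSubgroup.closure (S : Set G))
    (htors : ∀ p : ℕ, p.Prime → {x : G | p • x = 0}.Finite) : Function.Bijective D := by
  obtain ⟨B, hB⟩ := hrank
  have := finiteDimensional_rat_tensorProduct B hB
  let e := LinearEquiv.ofBijective (D - N) hS
  let U : Module.End ℤ G := e.symm.toLinearMap
  have hSU : (D - N) * U = 1 := LinearMap.ext fun x => e.apply_symm_apply x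
  have hUS : U * (D - N) = 1 := LinearMap.ext fun x => e.symm_apply_apply x
  have hDmem : D ∈ Subsemiring.closure {D, N} := Subsemiring.subset_closure (by simp)
  have hNmem : N ∈ Subsemiring.closure {D, N} := Subsemiring.subset_closure (by simp)
  have hrat : IsNilpotent ((N * U).baseChange ℚ) := by
    let φ := Module.End.baseChangeHom ℤ ℚ G
    have hφ : IsNilpotent (φ N * φ U) := by
      refine isNilpotent_mul_of_forall_word (φ D) (φ N) (φ U) ?_ ?_
      · intro w hw
        rw [← Set.image_pair] at hw
        obtain ⟨w, hw₁, rfl⟩ : w ∈ (Submonoid.closure {D, N}).map φ.toRingHom.toMonoidHom := by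
          rw [MonoidHom.map_mclosure]
          exact hw
        have : w ∈ Subsemiring.closure {D, N} :=
          (Submonoid.closure_le (S := (Subsemiring.closure {D, N}).toSubmonoid)).2
            Subsemiring.subset_closure hw₁
        have hw' := (hnil w this).map φ
        rw [map_mul] at hw'
        exact hw'
      · rw [← map_sub, ← map_mul, hSU, map_one]
    rw [← map_mul] at hφ
    exact hφ
  have htor : ∀ m : ℕ, m ≠ 0 → ∀ x : G, m • x = 0 → ∃ r : ℕ, ((N * U) ^ r) x = 0 := by
    intro m hm
    have hfin := finite_torsionBy_of_forall_prime htors m hm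
    let T : Set G := {x : G | m • x = 0}
    have hT : ∀ (F : Module.End ℤ G) (x : G), x ∈ T → F x ∈ T := by
      intro F x hx
      change m • F x = 0
      rw [← map_nsmul, show m • x = 0 from hx, map_zero]
    have : Finite T := hfin
    let σ : Equiv.Perm T :=
      { toFun := fun x => ⟨(D - N) x, hT _ _ x.2⟩
        invFun := fun x => ⟨U x, hT _ _ x.2⟩
        left_inv := fun x => Subtype.ext (LinearMap.congr_fun hUS (x : G))
        right_inv := fun x => Subtype.ext (LinearMap.congr_fun hSU (x : G)) }
    obtain ⟨j, hj, hσ⟩ := (isOfFinOrder_of_finite σ).exists_pow_eq_one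
    obtain ⟨j, rfl⟩ := Nat.exists_eq_succ_of_ne_zero hj.ne'
    -- On `m`-torsion `-N = (m - 1) N`, so `D - N` agrees there with an element formed without
    -- subtraction. As `σ` has order dividing `j + 1`, its inverse is the `j`-th power.
    let q : Module.End ℤ G := (D + (m - 1) • N) ^ j
    have hq : q ∈ Subsemiring.closure {D, N} :=
      pow_mem (add_mem hDmem (nsmul_mem hNmem _)) j
    have hqT : ∀ x ∈ T, (D + (m - 1) • N) x = (D - N) x := by
      intro x hx
      have h0 : m • N x = 0 := hT N x hx
      have h1 : (m - 1) • N x + N x = 0 := by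
        rw [← succ_nsmul, Nat.sub_add_cancel (Nat.one_le_iff_ne_zero.2 hm), h0]
      rw [LinearMap.add_apply, LinearMap.smul_apply, LinearMap.sub_apply,
        eq_neg_of_add_eq_zero_left h1, sub_eq_add_neg]
    have hpow : ∀ (i : ℕ) (x : T), ((D + (m - 1) • N) ^ i) (x : G) = ((σ ^ i) x : T) := by
      intro i
      induction i with
      | zero => simp
      | succ i ih =>
        intro x
        rw [pow_succ', Module.End.mul_apply, ih, hqT _ (Subtype.coe_prop _), pow_succ']
        rfl
    have hU : ∀ x ∈ T, U x = q x := by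
      intro x hx
      rw [show q x = _ from hpow j ⟨x, hx⟩]
      have : σ⁻¹ = σ ^ j := inv_eq_of_mul_eq_one_left (by rw [← pow_succ]; exact hσ)
      rw [← this]
      rfl
    obtain ⟨r, hr⟩ := hnil q hq
    intro x hx
    refine ⟨r, ?_⟩
    have : ∀ i : ℕ, ((N * U) ^ i) x = ((N * q) ^ i) x := by
      intro i
      induction i with
      | zero => rfl
      | succ i ih =>
        rw [pow_succ', pow_succ', Module.End.mul_apply, Module.End.mul_apply (N * q), ← ih,
          Module.End.mul_apply, Module.End.mul_apply N q, hU _ (hT _ x hx)]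
    rw [this, hr, LinearMap.zero_apply]
  -- Rational nilpotency makes a power of `N * U` send `x` to a torsion element; `htor` then kills
  -- that element.
  have hloc : ∀ x, ∃ r : ℕ, ((N * U) ^ r) x = 0 := by
    intro x
    obtain ⟨r, hr⟩ := hrat
    have h1 : (1 : ℚ) ⊗ₜ[ℤ] (((N * U) ^ r) x) = 0 := by
      rw [← LinearMap.baseChange_tmul, LinearMap.baseChange_pow, hr, LinearMap.zero_apply]
    obtain ⟨m, hm, hx⟩ := exists_nsmul_eq_zero_of_one_tmul_eq_zero h1
    obtain ⟨s, hs⟩ := htor m hm _ hx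
    exact ⟨s + r, by rw [pow_add, Module.End.mul_apply, hs]⟩
  have hD : D = (1 + N * U) * (D - N) := by
    rw [add_mul, one_mul, mul_assoc, hUS, mul_one, sub_add_cancel]
  rw [hD]
  exact (Module.End.bijective_one_add_of_locally_nilpotent _ hloc).comp hS

end AbelianGroup

theorem CommGroup.finite_setOf_pow_eq_one {G : Type*} [CommGroup G] (p : ℕ) [Fact p.Prime]
    [Finite (CommGroup.primaryComponent G p)] : {x : G | x ^ p = 1}.Finite := by
  refine (Set.toFinite (CommGroup.primaryComponent G p : Set G)).subset fun x hx => ?_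
  exact ⟨1, by rwa [pow_one]⟩

/-! ### Block matrices and Schur complements -/

section BlockMatrix

variable {H G : Type*} [Group H] [CommGroup G] {A E : H →* H} {B : G →* H} {C : H →* G}
  {D : G →* G}

theorem bijective_schur_complement (hEA : ∀ x, E (A x) = x) (hAE : ∀ x, A (E x) = x)
    (hF : Function.Bijective fun z : H × G => (A z.1 * B z.2, C z.1 * D z.2)) :
    Function.Bijective fun y => D y * (C (E (B y)))⁻¹ := by
  constructor
  · intro y₁ y₂ h
    -- The first entry is chosen so that the block matrix sends the pair to `(1, D y * (C (E (B
    -- y)))⁻¹)`.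
    have h' : (fun z : H × G => (A z.1 * B z.2, C z.1 * D z.2)) (E (B y₁)⁻¹, y₁) =
        (fun z : H × G => (A z.1 * B z.2, C z.1 * D z.2)) (E (B y₂)⁻¹, y₂) := by
      have h₁ : D y₁ * (C (E (B y₁)))⁻¹ = D y₂ * (C (E (B y₂)))⁻¹ := h
      simp only [hAE, inv_mul_cancel, map_inv]
      rw [mul_comm, h₁, mul_comm]
    exact congrArg Prod.snd (hF.1 h')
  · intro z
    obtain ⟨⟨x, y⟩, hxy⟩ := hF.2 (1, z)
    simp only [Prod.mk.injEq] at hxy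
    obtain ⟨h₁, h₂⟩ := hxy
    refine ⟨y, ?_⟩
    have hx : x = (E (B y))⁻¹ := by
      rw [← hEA x, eq_inv_of_mul_eq_one_left h₁, map_inv]
    rw [← h₂, hx, map_inv, mul_comm]

/-- Let `(A B; C D)` be an invertible block matrix of group homomorphisms with `A` invertible, and
suppose that `C * a` is nilpotent for all `a` in a set of maps that contains the trivial map and is
closed under adding `A⁻¹ * B * v` for words `v` in `D` and `C * A⁻¹ * B`. If the target of `D` is of
finite rank with finite primary components, then `D` is invertible. -/
theorem bijective_of_block_matrix (hEA : ∀ x, E (A x) = x) (hAE : ∀ x, A (E x) = x)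
    (hF : Function.Bijective fun z : H × G => (A z.1 * B z.2, C z.1 * D z.2))
    (R : Set (G → H)) (W : Set (G → G)) (hR : (fun _ => 1) ∈ R) (hW : id ∈ W)
    (hWcomp : ∀ v ∈ W, ∀ w ∈ W, v ∘ w ∈ W)
    (hD : ⇑D ∈ W) (hN : (fun y => C (E (B y))) ∈ W)
    (hadd : ∀ a ∈ R, ∀ v ∈ W, (fun y => a y * E (B (v y))) ∈ R)
    (hnil : ∀ a ∈ R, ∃ m : ℕ, ∀ y, (fun y => C (a y))^[m] y = 1)
    (hrank : HasFiniteRank G)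
    (hfin : ∀ (p : ℕ) [Fact p.Prime], Finite (CommGroup.primaryComponent G p)) :
    Function.Bijective D := by
  let D' : Module.End ℤ (Additive G) := (MonoidHom.toAdditive D).toIntLinearMap
  let N' : Module.End ℤ (Additive G) :=
    (MonoidHom.toAdditive (C.comp (E.comp B))).toIntLinearMap
  have hword : ∀ w ∈ Submonoid.closure {D', N'},
      (fun y : G => (w (Additive.ofMul y)).toMul) ∈ W := by
    intro w hw
    induction hw using Submonoid.closure_induction with
    | mem w hw =>
      rcases hw with rfl | rfl
      · exact hD
      · exact hN
    | one => exact hW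
    | mul v w _ _ hv hw => exact hWcomp _ hv _ hw
  have hsum : ∀ q ∈ Subsemiring.closure {D', N'},
      (fun y : G => E (B (q (Additive.ofMul y)).toMul)) ∈ R := by
    intro q hq
    rw [Subsemiring.mem_closure_iff] at hq
    -- Adding one word at a time is all that `hadd` permits: `R` is not assumed closed under sums.
    induction hq using AddSubmonoid.closure_induction_right with
    | zero => simpa using hR
    | add_right q _ w hw hq =>
      have := hadd _ hq _ (hword w hw)
      simpa using this
  refine bijective_of_bijective_sub D' N' ?_ ?_ ?_ ?_
  · intro q hq
    obtain ⟨m, hm⟩ := hnil _ (hsum q hq)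
    refine ⟨m, LinearMap.ext fun y => ?_⟩
    rw [Module.End.pow_apply]
    exact hm y
  · have := bijective_schur_complement hEA hAE hF
    simp only [← div_eq_mul_inv] at this
    exact this
  · obtain ⟨S, hS⟩ := hrank
    refine ⟨S.map Additive.ofMul.toEmbedding, fun x => ?_⟩
    obtain ⟨m, hm, hx⟩ := hS x.toMul
    refine ⟨m, hm, ?_⟩
    have h : Additive.ofMul (x.toMul ^ m) ∈ Subgroup.toAddSubgroup (Subgroup.closure (S : Set G)) :=
      hx
    rw [Subgroup.toAddSubgroup_closure] at h
    have hset : ((S.map Additive.ofMul.toEmbedding : Finset (Additive G)) : Set (Additive G)) =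
        Additive.toMul ⁻¹' (S : Set G) := by
      rw [Finset.coe_map]
      exact Additive.ofMul.image_eq_preimage_symm (S : Set G)
    rw [hset]
    exact h
  · intro p hp
    have := Fact.mk hp
    have := hfin p
    exact CommGroup.finite_setOf_pow_eq_one (G := G) p

end BlockMatrix

/-! ### Induced maps on homotopy groups of products -/

namespace BasedSpace

variable {X : BasedSpace.{u}} {Y : BasedSpace.{v}} {Z : BasedSpace.{w}}

namespace HtpyClass

/-- The class of the constant map. -/
def const (X : BasedSpace.{u}) (Y : BasedSpace.{v}) : HtpyClass X Y :=
  Quotient.mk _ ⟨ContinuousMap.const _ Y.pt, rfl⟩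

@[simp]
theorem onPi_id (k : ℕ) (a : Pi k X) : (HtpyClass.id X).onPi k a = a := by
  induction a using Quotient.inductionOn with
  | h p => rfl

@[simp]
theorem onPi_comp (k : ℕ) (g : HtpyClass Y Z) (f : HtpyClass X Y) (a : Pi k X) :
    (g.comp f).onPi k a = g.onPi k (f.onPi k a) := by
  induction g using Quotient.inductionOn
  induction f using Quotient.inductionOn
  induction a using Quotient.inductionOn
  rfl

@[simp]
theorem onPi_const (k : ℕ) (a : Pi k X) : (const X Y).onPi k a = piTrivial k Y := by
  induction a using Quotient.inductionOn
  rfl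

@[simp]
theorem onPi_piTrivial (k : ℕ) (f : HtpyClass X Y) : f.onPi k (piTrivial k X) = piTrivial k Y := by
  induction f using Quotient.inductionOn with
  | h f => exact congrArg (Quotient.mk _) (GenLoop.ext _ _ fun _ => f.2)

theorem onPi_mul (k : ℕ) (f : HtpyClass X Y) (a b : Pi (k + 1) X) :
    f.onPi (k + 1) (a * b) = f.onPi (k + 1) a * f.onPi (k + 1) b := by
  induction f using Quotient.inductionOn with | h f => ?_
  induction a using Quotient.inductionOn with | h p => ?_
  induction b using Quotient.inductionOn with | h q => ?_
  have h₁ := HomotopyGroup.mul_spec (i := (0 : Fin (k + 1))) (p := p) (q := q)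
  have h₂ := HomotopyGroup.mul_spec (i := (0 : Fin (k + 1)))
    (p := (⟨f.1.comp p.1, fun y hy => (congrArg f.1 (p.2 y hy)).trans f.2⟩ :
      GenLoop (Fin (k + 1)) Y.carrier Y.pt))
    (q := (⟨f.1.comp q.1, fun y hy => (congrArg f.1 (q.2 y hy)).trans f.2⟩ :
      GenLoop (Fin (k + 1)) Y.carrier Y.pt))
  refine (congrArg (f.onPi (k + 1)) h₁).trans (Eq.trans ?_ h₂.symm)
  refine congrArg (Quotient.mk _) (GenLoop.ext _ _ fun t => ?_)
  exact apply_ite f.1 _ _ _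

/-- The homomorphism `π_{k+1}(f)`. -/
noncomputable def onPiHom (k : ℕ) (f : HtpyClass X Y) : Pi (k + 1) X →* Pi (k + 1) Y :=
  MonoidHom.mk' (f.onPi (k + 1)) (onPi_mul k f)

@[simp]
theorem projFst_comp_pair (f : HtpyClass Z X) (g : HtpyClass Z Y) :
    (projFst X Y).comp (f.pair g) = f := by
  induction f using Quotient.inductionOn
  induction g using Quotient.inductionOn
  rfl

@[simp]
theorem projSnd_comp_pair (f : HtpyClass Z X) (g : HtpyClass Z Y) :
    (projSnd X Y).comp (f.pair g) = g := by
  induction f using Quotient.inductionOn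
  induction g using Quotient.inductionOn
  rfl

@[simp]
theorem onPi_projFst_pair (k : ℕ) (f : HtpyClass Z X) (g : HtpyClass Z Y) (a : Pi k Z) :
    (projFst X Y).onPi k ((f.pair g).onPi k a) = f.onPi k a := by
  rw [← onPi_comp, projFst_comp_pair]

@[simp]
theorem onPi_projSnd_pair (k : ℕ) (f : HtpyClass Z X) (g : HtpyClass Z Y) (a : Pi k Z) :
    (projSnd X Y).onPi k ((f.pair g).onPi k a) = g.onPi k a := by
  rw [← onPi_comp, projSnd_comp_pair]

end HtpyClass

open HtpyClass

/-- The inclusion `Y → X × Y`, `y ↦ (*, y)`. -/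
def inclSnd (X : BasedSpace.{u}) (Y : BasedSpace.{v}) : HtpyClass Y (X.prod Y) :=
  Quotient.mk _ ⟨⟨fun y => (X.pt, y), by fun_prop⟩, rfl⟩

@[simp]
theorem onPi_projFst_inclFst (k : ℕ) (a : Pi k X) :
    (projFst X Y).onPi k ((inclFst X Y).onPi k a) = a := by
  induction a using Quotient.inductionOn
  rfl

@[simp]
theorem onPi_projSnd_inclFst (k : ℕ) (a : Pi k X) :
    (projSnd X Y).onPi k ((inclFst X Y).onPi k a) = piTrivial k Y := by
  induction a using Quotient.inductionOn
  rfl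

@[simp]
theorem onPi_projFst_inclSnd (k : ℕ) (a : Pi k Y) :
    (projFst X Y).onPi k ((inclSnd X Y).onPi k a) = piTrivial k X := by
  induction a using Quotient.inductionOn
  rfl

@[simp]
theorem onPi_projSnd_inclSnd (k : ℕ) (a : Pi k Y) :
    (projSnd X Y).onPi k ((inclSnd X Y).onPi k a) = a := by
  induction a using Quotient.inductionOn
  rfl

/-- The bijection `π_k(X × Y) ≃ π_k(X) × π_k(Y)` given by the projections. -/
theorem bijective_onPi_projections (k : ℕ) : Function.Bijective fun a : Pi k (X.prod Y) =>
    ((projFst X Y).onPi k a, (projSnd X Y).onPi k a) := by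
  constructor
  · intro a b h
    induction a using Quotient.inductionOn with | h p => ?_
    induction b using Quotient.inductionOn with | h q => ?_
    have h₁ := Quotient.exact (congrArg Prod.fst h)
    have h₂ := Quotient.exact (congrArg Prod.snd h)
    exact Quotient.sound (Nonempty.map2 ContinuousMap.HomotopyRel.prod h₁ h₂)
  · rintro ⟨a, b⟩
    induction a using Quotient.inductionOn with | h p => ?_
    induction b using Quotient.inductionOn with | h q => ?_
    exact ⟨Quotient.mk _ ⟨ContinuousMap.prodMk p.1 q.1,
      fun y hy => Prod.ext (p.2 y hy) (q.2 y hy)⟩, rfl⟩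

theorem pi_prod_ext {k : ℕ} {a b : Pi k (X.prod Y)}
    (h₁ : (projFst X Y).onPi k a = (projFst X Y).onPi k b)
    (h₂ : (projSnd X Y).onPi k a = (projSnd X Y).onPi k b) : a = b :=
  (bijective_onPi_projections k).1 (Prod.ext h₁ h₂)

theorem exists_pi_prod (k : ℕ) (x : Pi k X) (y : Pi k Y) : ∃ a : Pi k (X.prod Y),
    (projFst X Y).onPi k a = x ∧ (projSnd X Y).onPi k a = y := by
  obtain ⟨a, ha⟩ := (bijective_onPi_projections k).2 (x, y)
  exact ⟨a, congrArg Prod.fst ha, congrArg Prod.snd ha⟩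

/-- Each element of `π_{k+1}(X × Y)` is the product of its two components, included back; this gives
the block matrix of a self-map. -/
theorem onPi_eq_mul (k : ℕ) (h : HtpyClass (X.prod Y) Z) (a : Pi (k + 1) (X.prod Y)) :
    h.onPi (k + 1) a =
      (h.comp (inclFst X Y)).onPi (k + 1) ((projFst X Y).onPi (k + 1) a) *
        (h.comp (inclSnd X Y)).onPi (k + 1) ((projSnd X Y).onPi (k + 1) a) := by
  rw [onPi_comp, onPi_comp, ← onPi_mul]
  congr 1
  apply pi_prod_ext
  · rw [onPi_mul, onPi_projFst_inclFst, onPi_projFst_inclSnd]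
    exact (mul_one _).symm
  · rw [onPi_mul, onPi_projSnd_inclFst, onPi_projSnd_inclSnd]
    exact (one_mul _).symm

theorem subsingleton_pi_zero [PathConnectedSpace X.carrier] : Subsingleton (Pi 0 X) := by
  have : Subsingleton (ZerothHomotopy X.carrier) :=
    (pathConnectedSpace_iff_zerothHomotopy.1 inferInstance).2
  exact HomotopyGroup.pi0EquivZerothHomotopy.subsingleton

end BasedSpace

/-! ### Blocks of a self-map of the product -/

namespace BasedSpace

open HtpyClass

variable {X : BasedSpace.{u}} {Y : BasedSpace.{v}}

/-- `f_YY = p_Y ∘ f ∘ i_Y`. -/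
def blockSnd (f : HtpyClass (X.prod Y) (X.prod Y)) : HtpyClass Y Y :=
  ((projSnd X Y).comp f).comp (inclSnd X Y)

/-- `(f_X, p_Y)` preserves the second component, so it restricts to the elements whose second
component is trivial. No group structure enters, so `k = 0` is covered. -/
theorem bijective_onPi_blockFst {k : ℕ} {f : HtpyClass (X.prod Y) (X.prod Y)}
    (hf : Function.Bijective ((((projFst X Y).comp f).pair (projSnd X Y)).onPi k)) :
    Function.Bijective ((blockFst f).onPi k) := by
  constructor
  · intro a b hab
    have h : (inclFst X Y).onPi k a = (inclFst X Y).onPi k b := by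
      refine hf.1 (pi_prod_ext ?_ ?_)
      · simpa [blockFst] using hab
      · simp
    simpa using congrArg ((projFst X Y).onPi k) h
  · intro x
    obtain ⟨z, hz₁, hz₂⟩ := exists_pi_prod k x (piTrivial k Y)
    obtain ⟨a, rfl⟩ := hf.2 z
    refine ⟨(projFst X Y).onPi k a, ?_⟩
    have ha : a = (inclFst X Y).onPi k ((projFst X Y).onPi k a) := by
      apply pi_prod_ext <;> simp_all
    rw [onPi_projFst_pair] at hz₁
    rw [blockFst, onPi_comp, ← ha, hz₁]

/-- Back-substitution in a triangular matrix, with the order of factors kept because `π_1` may be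
nonabelian. -/
theorem bijective_onPi_pair_projSnd {k : ℕ} {f : HtpyClass (X.prod Y) (X.prod Y)}
    (hf : Function.Bijective ((blockFst f).onPi (k + 1))) :
    Function.Bijective ((((projFst X Y).comp f).pair (projSnd X Y)).onPi (k + 1)) := by
  constructor
  · intro a b hab
    have h₂ := congrArg ((projSnd X Y).onPi (k + 1)) hab
    have h₁ := congrArg ((projFst X Y).onPi (k + 1)) hab
    rw [onPi_projSnd_pair, onPi_projSnd_pair] at h₂
    rw [onPi_projFst_pair, onPi_projFst_pair, onPi_eq_mul, onPi_eq_mul k _ b, h₂,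
      mul_left_inj] at h₁
    exact pi_prod_ext (hf.1 h₁) h₂
  · intro z
    obtain ⟨x, hx⟩ := hf.2 ((projFst X Y).onPi (k + 1) z *
      ((((projFst X Y).comp f).comp (inclSnd X Y)).onPi (k + 1)
        ((projSnd X Y).onPi (k + 1) z))⁻¹)
    obtain ⟨a, rfl, ha⟩ := exists_pi_prod (k + 1) x ((projSnd X Y).onPi (k + 1) z)
    refine ⟨a, pi_prod_ext ?_ ?_⟩
    · rw [onPi_projFst_pair, onPi_eq_mul, ha, ← blockFst, hx, inv_mul_cancel_right]
    · rw [onPi_projSnd_pair, ha]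

theorem bijective_onPi_pair_projFst {k : ℕ} {f : HtpyClass (X.prod Y) (X.prod Y)}
    (hf : Function.Bijective ((blockSnd f).onPi (k + 1))) :
    Function.Bijective (((projFst X Y).pair ((projSnd X Y).comp f)).onPi (k + 1)) := by
  constructor
  · intro a b hab
    have h₂ := congrArg ((projSnd X Y).onPi (k + 1)) hab
    have h₁ := congrArg ((projFst X Y).onPi (k + 1)) hab
    rw [onPi_projFst_pair, onPi_projFst_pair] at h₁
    rw [onPi_projSnd_pair, onPi_projSnd_pair, onPi_eq_mul, onPi_eq_mul k _ b, h₁,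
      mul_right_inj] at h₂
    exact pi_prod_ext h₁ (hf.1 h₂)
  · intro z
    obtain ⟨y, hy⟩ := hf.2
      (((((projSnd X Y).comp f).comp (inclFst X Y)).onPi (k + 1)
        ((projFst X Y).onPi (k + 1) z))⁻¹ * (projSnd X Y).onPi (k + 1) z)
    obtain ⟨a, ha, rfl⟩ := exists_pi_prod (k + 1) ((projFst X Y).onPi (k + 1) z) y
    refine ⟨a, pi_prod_ext ?_ ?_⟩
    · rw [onPi_projFst_pair, ha]
    · rw [onPi_projSnd_pair, onPi_eq_mul, ha, ← blockSnd, hy, mul_inv_cancel_left]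

theorem bijective_onPi_blockSnd {n : ℕ∞} {k : ℕ} (hk : ((k + 1 : ℕ) : ℕ∞) ≤ n)
    (hY : HasSmallPrimaryComponents (Pi (k + 1) Y)) (hdist : HomotopicallyDistant n X Y)
    {f : HtpyClass (X.prod Y) (X.prod Y)} (hf : Function.Bijective (f.onPi (k + 1)))
    (hfX : blockFst f ∈ X.selfEquivs) : Function.Bijective ((blockSnd f).onPi (k + 1)) := by
  obtain ⟨hcomm, hrank, hfin⟩ := hY
  obtain ⟨e, heA, hAe⟩ := hfX
  let _ : CommGroup (Pi (k + 1) Y) :=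
    { (inferInstance : Group (Pi (k + 1) Y)) with mul_comm := hcomm }
  let fXY : HtpyClass Y X := ((projFst X Y).comp f).comp (inclSnd X Y)
  let fYX : HtpyClass X Y := ((projSnd X Y).comp f).comp (inclFst X Y)
  refine bijective_of_block_matrix (A := onPiHom k (blockFst f)) (E := onPiHom k e)
    (B := onPiHom k fXY) (C := onPiHom k fYX) (D := onPiHom k (blockSnd f)) ?_ ?_ ?_
    (Set.range fun a : HtpyClass Y X => a.onPi (k + 1))
    (Set.range fun v : HtpyClass Y Y => v.onPi (k + 1)) ?_ ?_ ?_ ?_ ?_ ?_ ?_ hrank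
    (fun p _ => (hfin p).1)
  · intro x
    change e.onPi (k + 1) ((blockFst f).onPi (k + 1) x) = x
    rw [← onPi_comp, heA, onPi_id]
  · intro x
    change (blockFst f).onPi (k + 1) (e.onPi (k + 1) x) = x
    rw [← onPi_comp, hAe, onPi_id]
  · refine (Function.Bijective.of_comp_iff _
      (bijective_onPi_projections (X := X) (Y := Y) (k + 1))).1 ?_
    convert (bijective_onPi_projections (X := X) (Y := Y) (k + 1)).comp hf using 1
    funext a
    refine Prod.ext ?_ ?_
    · exact (onPi_eq_mul k ((projFst X Y).comp f) a).symm.trans (onPi_comp _ _ _ _)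
    · exact (onPi_eq_mul k ((projSnd X Y).comp f) a).symm.trans (onPi_comp _ _ _ _)
  · exact ⟨const Y X, funext fun a => onPi_const _ a⟩
  · exact ⟨HtpyClass.id Y, funext fun a => onPi_id _ a⟩
  · rintro _ ⟨v, rfl⟩ _ ⟨w, rfl⟩
    exact ⟨v.comp w, funext fun a => onPi_comp _ _ _ a⟩
  · exact ⟨blockSnd f, rfl⟩
  · refine ⟨fYX.comp (e.comp fXY), funext fun a => ?_⟩
    simp only [onPi_comp]
    rfl
  · rintro _ ⟨a, rfl⟩ _ ⟨v, rfl⟩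
    -- Maps `Y → X` cannot be added in general. Here `f_X ∘ (a, v)` induces `A a * B v`, and `e`
    -- cancels `A`.
    refine ⟨e.comp (((projFst X Y).comp f).comp (a.pair v)), funext fun y => ?_⟩
    simp only []
    rw [onPi_comp, onPi_comp _ ((projFst X Y).comp f), onPi_eq_mul, onPi_projFst_pair,
      onPi_projSnd_pair, onPi_mul]
    congr 1
    change e.onPi (k + 1) ((blockFst f).onPi (k + 1) _) = _
    rw [← onPi_comp, heA, onPi_id]
  · rintro _ ⟨a, rfl⟩
    obtain ⟨m, hm⟩ := hdist a fYX (k + 1) hk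
    refine ⟨m, fun y => ?_⟩
    rw [show (fun y => onPiHom k fYX (a.onPi (k + 1) y)) = (fYX.comp a).onPi (k + 1) from
      funext fun y => (onPi_comp _ _ _ y).symm]
    exact hm y

end BasedSpace

theorem proposition4p9 (X : BasedSpace.{u}) (Y : BasedSpace.{v})
    (hXconn : PathConnectedSpace X.carrier) (hYconn : PathConnectedSpace Y.carrier)
    (hXcw : X.HasCWHomotopyType) (hYcw : Y.HasCWHomotopyType)
    (n N : ℕ∞) (hN : X.IsSelfClosenessNumber N) (hn : N ≤ n)
    (hY : ∀ k : ℕ, ((k + 1 : ℕ) : ℕ∞) ≤ n →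
      HasSmallPrimaryComponents (BasedSpace.Pi (k + 1) Y))
    (hdist : BasedSpace.HomotopicallyDistant n X Y) :
    BasedSpace.IsReducible n X Y ↔
      ∀ f ∈ BasedSpace.A n (X.prod Y), BasedSpace.blockFst f ∈ X.selfEquivs := by
  constructor
  · intro h f hf
    have hA : BasedSpace.A N X = X.selfEquivs := hN.1
    rw [← hA]
    exact fun k hk => BasedSpace.bijective_onPi_blockFst ((h f hf).2 k (hk.trans hn))
  · intro h f hf
    have hprod : PathConnectedSpace (X.prod Y).carrier :=
      inferInstanceAs (PathConnectedSpace (X.carrier × Y.carrier))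
    -- Degree `0` has no group structure and is settled by path-connectedness.
    have hzero : ∀ g : BasedSpace.HtpyClass (X.prod Y) (X.prod Y),
        Function.Bijective (g.onPi 0) := by
      intro g
      have := BasedSpace.subsingleton_pi_zero (X := X.prod Y)
      exact ⟨Function.injective_of_subsingleton _, fun y => ⟨y, Subsingleton.elim _ _⟩⟩
    constructor
    · rintro (_ | k) hk
      · exact hzero _
      · exact BasedSpace.bijective_onPi_pair_projFst
          (BasedSpace.bijective_onPi_blockSnd hk (hY k hk) hdist (hf _ hk) (h f hf))
    · rintro (_ | k) hk
      · exact hzero _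
      · refine BasedSpace.bijective_onPi_pair_projSnd ?_
        obtain ⟨e, h₁, h₂⟩ := h f hf
        refine Function.bijective_iff_has_inverse.2 ⟨e.onPi (k + 1), fun a => ?_, fun a => ?_⟩
        · rw [← BasedSpace.HtpyClass.onPi_comp, h₁, BasedSpace.HtpyClass.onPi_id]
        · rw [← BasedSpace.HtpyClass.onPi_comp, h₂, BasedSpace.HtpyClass.onPi_id]
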